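/- Let $\theta:\mathbb N\to\mathbb N$ be a function. A function $h:R\to[0,\infty)$ on an integral domain $R$ is called a height function of $\theta$-type if for every $m\in\mathbb N$ and all $x,y\in R$ with $h(x)\le m$ and $h(y)\le m$ one has $h(x+y)\le\theta(m)$, $h(xy)\le\theta(m)$ and $h(-x)\le\theta(m)$. For a polynomial $f=\sum_\alpha a_\alpha X^\alpha\in R[X_1,\dots,X_n]$ put $h(f)=\max_\alpha h(a_\alpha)$, and let $\deg f$ be its total degree. Say that $R$ is a UFD with the p-property if $R$ is a unique factorization domain endowed with a real absolute value $|\cdot|$ such that every unit has absolute value $1$ and, whenever there are primes $p,q$ with $|p|<1<|q|$, there is a prime $r$ not associated to $p$ with $|r|<1$. Theorem. For all integers $n\ge1$, $D\ge1$ there is a constant $c_1=c_1(n,D)$, and for all real $H\ge 1$ and all $\theta:\mathbb N\to\mathbb N$ there is a constant $c_2=c_2(n,D,H,\theta)$, such that the following holds for every integral domain $R$, every height function $h$ of $\theta$-type on $R$ and every $s$. Let $K^{alg}$ be an algebraic closure of the field of fractions of $R$, and let $f_1,\dots,f_s\in R[X_1,\dots,X_n]$ have no common zero in $(K^{alg})^n$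 and satisfy $\deg f_i\le D$ and $h(f_i)\le H$ for all $i$. Then there are a nonzero $a\in R$ and $h_1,\dots,h_s\in R[X_1,\dots,X_n]$ such that (i) $a=f_1h_1+\dots+f_sh_s$; (ii) $\deg h_i\le c_1$ for all $i$; (iii) $h(a)\le c_2$ and $h(h_i)\le c_2$ for all $i$; (iv) if $R$ is a UFD with the p-property and $h=|\cdot|$ is its absolute value, then moreover $a$ and the $h_i$ can be chosen, with (i)–(iii) and the same $c_1,c_2$, so that the greatest common divisor of $a$ and all coefficients of $h_1,\dots,h_s$ is $1$. -/

import Mathlib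

open scoped NNReal

universe u

/-- `h : R → [0, ∞)` is a height function of `θ`-type: for every natural number `m`, sums,
products and negatives of elements of height at most `m` have height at most `θ m`. -/
structure IsHeightOfType {R : Type*} [CommRing R] (θ : ℕ → ℕ) (h : R → ℝ≥0) : Prop where
  add_le : ∀ (m : ℕ) (x y : R), h x ≤ m → h y ≤ m → h (x + y) ≤ θ m
  mul_le : ∀ (m : ℕ) (x y : R), h x ≤ m → h y ≤ m → h (x * y) ≤ θ m
  neg_le : ∀ (m : ℕ) (x : R), h x ≤ m → h (-x) ≤ θ m

/-- The extension of `h` to polynomials: the maximum of the heights of the coefficients.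
A polynomial has only finitely many distinct coefficients, so the supremum is a maximum. -/
noncomputable def polyHeight {R : Type*} [CommRing R] {n : ℕ} (h : R → ℝ≥0)
    (f : MvPolynomial (Fin n) R) : ℝ≥0 :=
  ⨆ α : Fin n →₀ ℕ, h (f.coeff α)

/-- The supremum defining `polyHeight` is taken over a bounded set. -/
theorem bddAbove_range_height_coeff {R : Type*} [CommRing R] {n : ℕ} (h : R → ℝ≥0)
    (f : MvPolynomial (Fin n) R) :
    BddAbove (Set.range fun α : Fin n →₀ ℕ => h (f.coeff α)) := by
  classical
  refine ⟨max (h 0) (f.support.sup fun α => h (f.coeff α)), ?_⟩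
  rintro _ ⟨α, rfl⟩
  by_cases hα : α ∈ f.support
  · exact le_max_of_le_right (Finset.le_sup (f := fun α => h (f.coeff α)) hα)
  · have h0 : f.coeff α = 0 := by simpa using hα
    simp [h0]

/-- `R`, with the absolute value `v`, is a UFD with the p-property. -/
structure IsUFDWithPProperty {R : Type*} [CommRing R] [IsDomain R]
    (v : AbsoluteValue R ℝ) : Prop where
  ufd : UniqueFactorizationMonoid R
  abs_unit : ∀ u : R, IsUnit u → v u = 1
  exists_prime : ∀ p q : R, Prime p → Prime q → v p < 1 → 1 < v q →
    ∃ r : R, Prime r ∧ ¬ Associated r p ∧ v r < 1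

/-- The polynomials `f i` have no common zero with coordinates in an algebraic closure of the
field of fractions of `R`. -/
def NoCommonZero {R : Type*} [CommRing R] [IsDomain R] {n s : ℕ}
    (f : Fin s → MvPolynomial (Fin n) R) : Prop :=
  ¬ ∃ x : Fin n → AlgebraicClosure (FractionRing R), ∀ i, MvPolynomial.aeval x (f i) = 0

/-!
The exponent `c₁` does not depend on the field because of a compactness argument. If every degree
`c` had a counterexample over an algebraically closed field `K c`, these would assemble to a system
over the ring `∏ c, K c`, which has dimension zero and algebraically closed residue fields. By the
Nullstellensatz for Jacobson rings the system generates the unit ideal, and a single certificate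
over the product projects to certificates of one degree for all factors.

Bounding the degrees turns `a = ∑ fᵢ hᵢ` into a linear system, with bounded size and with entries
among the coefficients of the `fᵢ`. Cramer's rule solves it over `R` by determinants of bounded
size: a spanning family of columns is completed to a square matrix by multiples `b • eₗ` of unit
vectors, where `b` is a coefficient of the `fᵢ`, and these columns do not enter the solution.

In a UFD with the p-property a common factor can be divided out without increasing absolute values
unless some prime is smaller than `1`, and all absolute values are at most `1` unless some prime is
larger than `1`. In the remaining case there are two non-associated primes `p`, `r` smaller than
`1`. If `s ≥ 2`, take a primitive certificate `(a, h)` and a primitive syzygy `w` of the `fᵢ`. Then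
`(pᵏ a, pᵏ h + rˡ z ^ (c + 1) w)` is again a primitive certificate, since the two summands have no
monomial in common, and for large `k`, `l` its coefficients have absolute value at most `1`.
-/

open MvPolynomial

section PiField

variable {κ : Type*} {K : κ → Type*} [∀ i, Field (K i)]

theorem krullDimLE_zero_pi : Ring.KrullDimLE 0 (∀ i, K i) := by
  refine Ring.KrullDimLE.mk₀ fun Q hQ => Ideal.isMaximal_iff.2
    ⟨Q.ne_top_iff_one.1 hQ.ne_top, fun J x hQJ hxQ hxJ => ?_⟩
  have hmul : x * (1 - x * x⁻¹) = 0 := by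
    funext i
    by_cases hi : x i = 0 <;> simp [hi]
  have hQ_mem : 1 - x * x⁻¹ ∈ Q := (hQ.mem_or_mem (hmul ▸ Q.zero_mem)).resolve_left hxQ
  simpa using J.add_mem (hQJ hQ_mem) (J.mul_mem_right x⁻¹ hxJ)

theorem exists_map_evalRingHom_eq {σ : Type*} [Finite σ] {D : ℕ}
    (f : ∀ i, MvPolynomial σ (K i)) (hf : ∀ i, (f i).totalDegree ≤ D) :
    ∃ F : MvPolynomial σ (∀ i, K i), ∀ i, F.map (Pi.evalRingHom K i) = f i := by
  classical
  refine ⟨∑ α ∈ (Finsupp.finite_of_degree_le D).toFinset, monomial α fun i => coeff α (f i),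
    fun i => ?_⟩
  ext β
  simp only [map_sum, map_monomial, coeff_sum, coeff_monomial, Finset.sum_ite_eq',
    Pi.evalRingHom_apply, Set.Finite.mem_toFinset, Set.mem_ofPred_eq, ite_eq_left_iff]
  intro hβ
  by_contra hne
  exact hβ ((le_totalDegree (mem_support_iff.2 (Ne.symm hne))).trans (hf i))

variable [∀ i, IsAlgClosed (K i)]

theorem exists_isRoot_pi_of_monic {p : Polynomial (∀ i, K i)} (hp : p.Monic)
    (hd : p.natDegree ≠ 0) : ∃ a, p.IsRoot a := by
  have hroot (i : κ) : ∃ a, (p.map (Pi.evalRingHom K i)).IsRoot a := by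
    refine IsAlgClosed.exists_root _ fun h0 => hd ?_
    rw [← hp.natDegree_map (Pi.evalRingHom K i)]
    exact Polynomial.natDegree_eq_zero_iff_degree_le_zero.2 h0.le
  choose a ha using hroot
  refine ⟨a, funext fun i => ?_⟩
  have heval := Polynomial.hom_eval₂ p (RingHom.id _) (Pi.evalRingHom K i) a
  rw [RingHom.comp_id, ← Polynomial.eval_map (Pi.evalRingHom K i)] at heval
  exact heval.trans (ha i)

theorem isAlgClosed_pi_quotient (Q : Ideal (∀ i, K i)) [Q.IsMaximal] :
    letI := Ideal.Quotient.field Q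
    IsAlgClosed ((∀ i, K i) ⧸ Q) := by
  let _ := Ideal.Quotient.field Q
  refine IsAlgClosed.of_exists_root _ fun p hp hirr => ?_
  obtain ⟨q, rfl, hdeg, hq⟩ := Polynomial.lifts_and_natDegree_eq_and_monic
    ((Polynomial.lifts_iff_coeff_lifts p).2 fun n => Ideal.Quotient.mk_surjective (p.coeff n)) hp
  obtain ⟨a, ha⟩ := exists_isRoot_pi_of_monic hq (hdeg ▸ hirr.natDegree_pos.ne')
  exact ⟨Ideal.Quotient.mk Q a, ha.map⟩

theorem surjective_of_isIntegral_pi {L : Type*} [CommRing L] [IsDomain L]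
    (φ : (∀ i, K i) →+* L) (hφ : φ.IsIntegral) : Function.Surjective φ := by
  have : Ring.KrullDimLE 0 (∀ i, K i) := krullDimLE_zero_pi
  have : (RingHom.ker φ).IsMaximal := Ideal.IsPrime.isMaximal' (RingHom.ker_isPrime φ)
  let _ := Ideal.Quotient.field (RingHom.ker φ)
  have := isAlgClosed_pi_quotient (RingHom.ker φ)
  exact (IsAlgClosed.ringHom_bijective_of_isIntegral φ.kerLift hφ.kerLift).2.comp
    Ideal.Quotient.mk_surjective

variable {σ : Type*} [Finite σ]

theorem exists_forall_not_isUnit_eval_pi {I : Ideal (MvPolynomial σ (∀ i, K i))} (hI : I ≠ ⊤) :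
    ∃ x : σ → ∀ i, K i, ∀ F ∈ I, ¬ IsUnit (eval x F) := by
  obtain ⟨M, hM, hIM⟩ := Ideal.exists_le_maximal I hI
  let _ := Ideal.Quotient.field M
  have : Ring.KrullDimLE 0 (∀ i, K i) := krullDimLE_zero_pi
  have hsurj := surjective_of_isIntegral_pi _
    (comp_C_integral_of_surjective_of_isJacobsonRing _ (Ideal.Quotient.mk_surjective (I := M)))
  choose x hx using fun j => hsurj (Ideal.Quotient.mk M (X j))
  have hcomp : ((Ideal.Quotient.mk M).comp C).comp (eval x) = Ideal.Quotient.mk M :=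
    MvPolynomial.ringHom_ext (fun r => by simp) fun j => by simpa using hx j
  refine ⟨x, fun F hF hunit => not_isUnit_zero (M₀ := MvPolynomial σ (∀ i, K i) ⧸ M) ?_⟩
  rw [← Ideal.Quotient.eq_zero_iff_mem.2 (hIM hF), ← hcomp]
  exact hunit.map ((Ideal.Quotient.mk M).comp C)

theorem span_forall_map_evalRingHom_mem_eq_top {D : ℕ} {S : ∀ i, Set (MvPolynomial σ (K i))}
    (hD : ∀ i, ∀ f ∈ S i, f.totalDegree ≤ D) (hS : ∀ i, ∀ x : σ → K i, ∃ f ∈ S i, eval x f ≠ 0) :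
    Ideal.span {F : MvPolynomial σ (∀ i, K i) | ∀ i, F.map (Pi.evalRingHom K i) ∈ S i} = ⊤ := by
  by_contra hI
  obtain ⟨x, hx⟩ := exists_forall_not_isUnit_eval_pi hI
  choose f hfS hf using fun i => hS i fun j => x j i
  obtain ⟨F, hF⟩ := exists_map_evalRingHom_eq f fun i => hD i _ (hfS i)
  refine hx F (Ideal.subset_span fun i => (hF i).symm ▸ hfS i)
    (Pi.isUnit_iff.2 fun i => isUnit_iff_ne_zero.2 ?_)
  have heval : eval x F i = eval (fun j => x j i) (f i) := by
    rw [← hF i, eval_map]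
    exact eval₂_comp_left (Pi.evalRingHom K i) (RingHom.id _) x F
  exact heval ▸ hf i

end PiField

section TruncatedIdeal

variable {σ k : Type*} [CommSemiring k]

/-- The multiples `X ^ α * f` of elements `f` of `S` by monomials of degree at most `c`. -/
def monomialMultiples (S : Set (MvPolynomial σ k)) (c : ℕ) : Set (MvPolynomial σ k) :=
  Set.image2 (fun α f => monomial α 1 * f) {α | α.degree ≤ c} S

/-- The combinations of elements of `S` with multipliers of degree at most `c`, a truncation of the
ideal generated by `S`. It contains `1` when `S` admits a Nullstellensatz certificate of degree
`c`. -/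
noncomputable def truncatedIdeal (S : Set (MvPolynomial σ k)) (c : ℕ) :
    Submodule k (MvPolynomial σ k) :=
  Submodule.span k (monomialMultiples S c)

theorem truncatedIdeal_mono (S : Set (MvPolynomial σ k)) : Monotone (truncatedIdeal S) :=
  fun _ _ hcd => Submodule.span_mono (Set.image2_subset_right fun _ hα => le_trans hα hcd)

theorem mul_mem_truncatedIdeal {S : Set (MvPolynomial σ k)} {c : ℕ} {f g : MvPolynomial σ k}
    (hf : f ∈ S) (hg : g.totalDegree ≤ c) : g * f ∈ truncatedIdeal S c := by
  rw [g.as_sum, Finset.sum_mul]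
  refine Submodule.sum_mem _ fun α hα => ?_
  have hα_smul : monomial α (coeff α g) = coeff α g • monomial α (1 : k) := by
    rw [smul_monomial, smul_eq_mul, mul_one]
  rw [hα_smul, smul_mul_assoc]
  exact Submodule.smul_mem _ _
    (Submodule.subset_span ⟨α, (le_totalDegree hα).trans hg, f, hf, rfl⟩)

theorem totalDegree_map_le {R : Type*} [CommSemiring R] (φ : R →+* k) (f : MvPolynomial σ R) :
    (f.map φ).totalDegree ≤ f.totalDegree :=
  Finset.sup_mono (support_map_subset _ _)

end TruncatedIdeal

section DegreeBound

variable {κ : Type*} {K : κ → Type*} [∀ i, Field (K i)]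

theorem exists_forall_map_evalRingHom_mem_truncatedIdeal {σ : Type*}
    {S : ∀ i, Set (MvPolynomial σ (K i))} {q : MvPolynomial σ (∀ i, K i)}
    (hq : q ∈ Ideal.span {F | ∀ i, F.map (Pi.evalRingHom K i) ∈ S i}) :
    ∃ c, ∀ i, q.map (Pi.evalRingHom K i) ∈ truncatedIdeal (S i) c := by
  induction hq using Submodule.closure_induction with
  | zero => exact ⟨0, fun i => by simp⟩
  | add _ _ _ _ hx hy =>
    obtain ⟨c, hc⟩ := hx
    obtain ⟨d, hd⟩ := hy
    refine ⟨max c d, fun i => ?_⟩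
    rw [map_add]
    exact add_mem (truncatedIdeal_mono _ (le_max_left c d) (hc i))
      (truncatedIdeal_mono _ (le_max_right c d) (hd i))
  | smul_mem G F hF =>
    refine ⟨G.totalDegree, fun i => ?_⟩
    rw [smul_eq_mul, map_mul]
    exact mul_mem_truncatedIdeal (hF i) (totalDegree_map_le _ _)

theorem exists_one_mem_truncatedIdeal (σ : Type*) [Finite σ] (D : ℕ) :
    ∃ c, ∀ (k : Type u) [Field k] [IsAlgClosed k] (S : Set (MvPolynomial σ k)),
      (∀ f ∈ S, f.totalDegree ≤ D) → (∀ x : σ → k, ∃ f ∈ S, eval x f ≠ 0) →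
      1 ∈ truncatedIdeal S c := by
  by_contra! H
  choose K _ _ S hD hS hnotMem using H
  obtain ⟨c, hc⟩ := exists_forall_map_evalRingHom_mem_truncatedIdeal (q := 1)
    (span_forall_map_evalRingHom_mem_eq_top hD hS ▸ Submodule.mem_top)
  exact hnotMem c (by simpa using hc c)

end DegreeBound

section Height

variable {θ : ℕ → ℕ} {m : ℕ}

/-- The bound, after `k` ring operations, for the heights of elements obtained from elements of
height at most `m`, when the height function is of `θ`-type. -/
def heightBound (θ : ℕ → ℕ) (m k : ℕ) : ℕ :=
  (fun b => max b (θ b))^[k] m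

theorem heightBound_mono : Monotone (heightBound θ m) :=
  fun _ _ hkl => Function.monotone_iterate_of_id_le (fun b => le_max_left b (θ b)) hkl m

theorem theta_heightBound_le (k : ℕ) : θ (heightBound θ m k) ≤ heightBound θ m (k + 1) := by
  rw [heightBound, heightBound, Function.iterate_succ_apply']
  exact le_max_right _ _

theorem heightBound_heightBound (k l : ℕ) :
    heightBound θ (heightBound θ m k) l = heightBound θ m (l + k) :=
  (Function.iterate_add_apply _ l k m).symm

theorem le_heightBound_mono {R : Type*} {h : R → ℝ≥0} {x : R} {k l : ℕ} (hkl : k ≤ l)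
    (hx : h x ≤ heightBound θ m k) : h x ≤ heightBound θ m l :=
  hx.trans (Nat.cast_le.2 (heightBound_mono hkl))

theorem le_heightBound_of_le {R : Type*} {h : R → ℝ≥0} {x : R} (hx : h x ≤ m) (k : ℕ) :
    h x ≤ heightBound θ m k :=
  le_heightBound_mono k.zero_le hx

/-- The number of ring operations allowed for in the expansion of a determinant of size `N`. -/
def detDepth (N : ℕ) : ℕ :=
  N + 1 + N.factorial

namespace IsHeightOfType

variable {R : Type*} [CommRing R] {h : R → ℝ≥0} (hh : IsHeightOfType θ h)
include hh

theorem add_le_heightBound {k : ℕ} {x y : R} (hx : h x ≤ heightBound θ m k)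
    (hy : h y ≤ heightBound θ m k) : h (x + y) ≤ heightBound θ m (k + 1) :=
  (hh.add_le _ x y hx hy).trans (Nat.cast_le.2 (theta_heightBound_le k))

theorem mul_le_heightBound {k : ℕ} {x y : R} (hx : h x ≤ heightBound θ m k)
    (hy : h y ≤ heightBound θ m k) : h (x * y) ≤ heightBound θ m (k + 1) :=
  (hh.mul_le _ x y hx hy).trans (Nat.cast_le.2 (theta_heightBound_le k))

theorem neg_le_heightBound {k : ℕ} {x : R} (hx : h x ≤ heightBound θ m k) :
    h (-x) ≤ heightBound θ m (k + 1) :=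
  (hh.neg_le _ x hx).trans (Nat.cast_le.2 (theta_heightBound_le k))

theorem zero_le_heightBound {x : R} (hx : h x ≤ m) : h 0 ≤ heightBound θ m 2 :=
  add_neg_cancel x ▸
    hh.add_le_heightBound (le_heightBound_of_le hx 1) (hh.neg_le_heightBound (k := 0) hx)

theorem sum_le_heightBound {k : ℕ} (h0 : h 0 ≤ heightBound θ m k) {κ : Type*} (s : Finset κ)
    {x : κ → R} (hx : ∀ i ∈ s, h (x i) ≤ heightBound θ m k) :
    h (∑ i ∈ s, x i) ≤ heightBound θ m (k + s.card) := by
  induction s using Finset.cons_induction with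
  | empty => simpa using h0
  | cons a s ha ih =>
    rw [Finset.sum_cons, Finset.card_cons, ← add_assoc]
    exact hh.add_le_heightBound
      (le_heightBound_mono (Nat.le_add_right _ _) (hx a (Finset.mem_cons_self a s)))
      (ih fun i hi => hx i (Finset.mem_cons_of_mem hi))

theorem prod_le_heightBound {k : ℕ} {κ : Type*} {s : Finset κ} (hs : s.Nonempty) {x : κ → R}
    (hx : ∀ i ∈ s, h (x i) ≤ heightBound θ m k) :
    h (∏ i ∈ s, x i) ≤ heightBound θ m (k + s.card) := by
  induction hs using Finset.Nonempty.cons_induction with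
  | singleton a =>
    rw [Finset.prod_singleton]
    exact le_heightBound_mono (Nat.le_add_right _ _) (hx a (Finset.mem_singleton_self a))
  | cons a s ha _ ih =>
    rw [Finset.prod_cons, Finset.card_cons, ← add_assoc]
    exact hh.mul_le_heightBound
      (le_heightBound_mono (Nat.le_add_right _ _) (hx a (Finset.mem_cons_self a s)))
      (ih fun i hi => hx i (Finset.mem_cons_of_mem hi))

theorem det_le_heightBound {ι : Type*} [Fintype ι] [DecidableEq ι] [Nonempty ι] (h0 : h 0 ≤ m)
    {M : Matrix ι ι R} (hM : ∀ i j, h (M i j) ≤ m) :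
    h M.det ≤ heightBound θ m (detDepth (Fintype.card ι)) := by
  rw [Matrix.det_apply, detDepth, ← Fintype.card_perm, ← Finset.card_univ (α := Equiv.Perm ι)]
  refine hh.sum_le_heightBound (le_heightBound_of_le h0 _) _ fun σ _ => ?_
  have hprod : h (∏ i, M (σ i) i) ≤ heightBound θ m (Fintype.card ι) := by
    simpa using hh.prod_le_heightBound (k := 0) Finset.univ_nonempty fun i _ => hM (σ i) i
  rcases Int.units_eq_one_or (Equiv.Perm.sign σ) with hσ | hσ
  · rw [hσ, one_smul]
    exact le_heightBound_mono (Nat.le_succ _) hprod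
  · rw [hσ, Units.neg_smul, one_smul]
    exact hh.neg_le_heightBound hprod

end IsHeightOfType

end Height

section LinearAlgebra

open Module in
theorem exists_basis_mem_or_repr_eq_zero {ι K V : Type*} [Field K] [AddCommGroup V]
    [Module K V] (δ : Basis ι K V) {A : Set V} {v : V} (hv : v ∈ Submodule.span K A) :
    ∃ γ : Basis ι K V, ∀ k, γ k ∈ A ∨ γ k ∈ Set.range δ ∧ γ.repr v k = 0 := by
  obtain ⟨b₀, hb₀A, hspan, hli₀⟩ := exists_linearIndependent K A
  obtain ⟨b, hb, hb₀b, hspan_b, hli⟩ := exists_linearIndepOn_id_extension (K := K)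
    (t := b₀ ∪ Set.range δ) hli₀ Set.subset_union_left
  have htop : ⊤ ≤ Submodule.span K (Set.range ((↑) : b → V)) := by
    rw [Subtype.range_coe, ← δ.span_eq, Submodule.span_le]
    exact Set.subset_union_right.trans hspan_b
  let β : Basis b K V := Basis.mk hli htop
  let ε : b ≃ ι := β.indexEquiv δ
  let γ := β.reindex ε
  have hγ (k : ι) : γ k = ε.symm k := by simp [γ, β]
  have hsupp : ↑(γ.repr v).support ⊆ γ ⁻¹' b₀ := by
    rw [← Basis.mem_span_image, Set.image_preimage_eq_of_subset, hspan]
    · exact hv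
    · exact fun w hw => ⟨ε ⟨w, hb₀b hw⟩, by simp [hγ]⟩
  refine ⟨γ, fun k => or_iff_not_imp_left.2 fun hk => ⟨?_, ?_⟩⟩
  · exact (hγ k ▸ hb (ε.symm k).2).resolve_left fun h => hk (hb₀A h)
  · by_contra hne
    exact hk (hb₀A (hsupp (Finsupp.mem_support_iff.2 hne)))

theorem cramer_eq_det_mul_repr {ι K : Type*} [Fintype ι] [DecidableEq ι] [CommRing K]
    {M : Matrix ι ι K} {γ : Module.Basis ι K (ι → K)} (hM : M.col = γ) (w : ι → K) (k : ι) :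
    M.cramer w k = M.det * γ.repr w k := by
  have hw : M.mulVec (γ.repr w) = w := by
    simp only [Matrix.mulVec_eq_sum, op_smul_eq_smul]
    change ∑ i, γ.repr w i • M.col i = w
    rw [hM, γ.sum_repr]
  have hcramer : M.cramer w = M.det • ⇑(γ.repr w) := by
    conv_lhs => rw [← hw]
    rw [Matrix.cramer_eq_adjugate_mulVec, Matrix.mulVec_mulVec, Matrix.adjugate_mul,
      Matrix.smul_mulVec, Matrix.one_mulVec]
  rw [hcramer, Pi.smul_apply, smul_eq_mul]

theorem map_cramer {ι R S : Type*} [Fintype ι] [DecidableEq ι] [CommRing R] [CommRing S]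
    (φ : R →+* S) (M : Matrix ι ι R) (w : ι → R) (k : ι) :
    φ (M.cramer w k) = (M.map φ).cramer (φ ∘ w) k := by
  rw [Matrix.cramer_eq_adjugate_mulVec, Matrix.cramer_eq_adjugate_mulVec, RingHom.map_mulVec,
    ← RingHom.mapMatrix_apply, ← RingHom.mapMatrix_apply, RingHom.map_adjugate]

theorem exists_matrix_col_mem_or_cramer_eq_zero {R K ι : Type*} [CommRing R] [Field K]
    [Algebra R K] [FaithfulSMul R K] [Fintype ι] [DecidableEq ι] {U : Set (ι → R)} {c : R}
    (hc : c ≠ 0) {w : ι → R}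
    (hw : algebraMap R K ∘ w ∈ Submodule.span K ((algebraMap R K ∘ ·) '' U)) :
    ∃ M : Matrix ι ι R, M.det ≠ 0 ∧
      ∀ k, M.col k ∈ U ∨ M.col k ∈ Set.range (Pi.single · c) ∧ M.cramer w k = 0 := by
  have hinj := FaithfulSMul.algebraMap_injective R K
  have hcK : algebraMap R K c ≠ 0 := (map_ne_zero_iff _ hinj).2 hc
  obtain ⟨γ, hγ⟩ := exists_basis_mem_or_repr_eq_zero
    ((Pi.basisFun K ι).isUnitSMul fun _ => hcK.isUnit) hw
  have hlift (k : ι) : ∃ u : ι → R, algebraMap R K ∘ u = γ k ∧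
      (u ∈ U ∨ u ∈ Set.range (Pi.single · c) ∧ γ.repr (algebraMap R K ∘ w) k = 0) := by
    rcases hγ k with ⟨u, hu, huγ⟩ | ⟨⟨i, hi⟩, hk⟩
    · exact ⟨u, huγ, Or.inl hu⟩
    · refine ⟨Pi.single i c, ?_, Or.inr ⟨⟨i, rfl⟩, hk⟩⟩
      rw [← hi, Module.Basis.isUnitSMul_apply, Pi.basisFun_apply]
      ext l
      obtain rfl | hl := eq_or_ne l i <;> simp [*]
  choose u huγ hu using hlift
  let M : Matrix ι ι R := (Matrix.of u).transpose
  have hMγ : (M.map (algebraMap R K)).col = γ := funext huγ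
  have hdet : IsUnit (M.map (algebraMap R K)) :=
    Matrix.linearIndependent_cols_iff_isUnit.1 (hMγ ▸ γ.linearIndependent)
  refine ⟨M, fun h0 => ?_, fun k => (hu k).imp_right fun ⟨hcol, hk⟩ => ⟨hcol, hinj ?_⟩⟩
  · rw [Matrix.isUnit_iff_isUnit_det, ← RingHom.mapMatrix_apply, ← RingHom.map_det, h0,
      map_zero] at hdet
    exact not_isUnit_zero hdet
  · rw [map_cramer, cramer_eq_det_mul_repr hMγ, hk, mul_zero, map_zero]

theorem IsHeightOfType.exists_bounded_solution {R ι : Type*} (K : Type*) [CommRing R] [Field K]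
    [Algebra R K] [FaithfulSMul R K] [Fintype ι] {θ : ℕ → ℕ} {h : R → ℝ≥0}
    (hh : IsHeightOfType θ h) {m : ℕ} (h0 : h 0 ≤ m) {U : Set (ι → R)}
    (hU : ∀ u ∈ U, ∀ i, h (u i) ≤ m) {w : ι → R} (hw0 : w ≠ 0) (hwm : ∀ i, h (w i) ≤ m)
    (hw : algebraMap R K ∘ w ∈ Submodule.span K ((algebraMap R K ∘ ·) '' U)) :
    ∃ a ≠ 0, ∃ (x : ι → R) (u : ι → ι → R), (∀ k, u k ∈ U) ∧ ∑ k, x k • u k = a • w ∧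
      h a ≤ heightBound θ m (detDepth (Fintype.card ι)) ∧
      ∀ k, h (x k) ≤ heightBound θ m (detDepth (Fintype.card ι)) := by
  classical
  obtain ⟨l, hl⟩ := Function.ne_iff.1 hw0
  obtain ⟨u₀, hu₀⟩ : U.Nonempty := by
    by_contra! hempty
    simp only [hempty, Set.image_empty, Submodule.span_empty, Submodule.mem_bot] at hw
    exact hl ((FaithfulSMul.algebraMap_eq_zero_iff R K).1 (congrFun hw l))
  have : Nonempty ι := ⟨l⟩
  obtain ⟨M, hdet, hM⟩ := exists_matrix_col_mem_or_cramer_eq_zero hl hw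
  have hMm (i k : ι) : h (M i k) ≤ m := by
    rcases hM k with hk | ⟨⟨j, hj⟩, -⟩
    · exact hU _ hk i
    · rw [← M.col_apply, ← hj]
      dsimp only
      rw [Pi.single_apply]
      split_ifs
      exacts [hwm l, h0]
  have hterm (k : ι) : ∃ u ∈ U, M.cramer w k • u = M.cramer w k • M.col k := by
    rcases hM k with hk | ⟨-, hk⟩
    · exact ⟨_, hk, rfl⟩
    · exact ⟨u₀, hu₀, by simp only [hk, zero_smul]⟩
  choose u hu hxu using hterm
  refine ⟨M.det, hdet, M.cramer w, u, hu, ?_, hh.det_le_heightBound h0 hMm, fun k => ?_⟩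
  · rw [← M.mulVec_cramer, Matrix.mulVec_eq_sum]
    simp only [hxu, op_smul_eq_smul]
    rfl
  · rw [Matrix.cramer_apply]
    refine hh.det_le_heightBound h0 fun i j => ?_
    rw [Matrix.updateCol_apply]
    split_ifs
    exacts [hwm i, hMm i j]

end LinearAlgebra

section Certificate

variable {σ : Type*}

/-- The exponents of the monomials of degree at most `N`. -/
abbrev ExponentLE (σ : Type*) (N : ℕ) : Type _ :=
  {α : σ →₀ ℕ // α.degree ≤ N}

noncomputable instance [Finite σ] (N : ℕ) : Fintype (ExponentLE σ N) :=
  (Finsupp.finite_of_degree_le N).fintype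

/-- The vector of the coefficients of a polynomial at the monomials of degree at most `N`, turning
polynomial identities into linear systems. -/
noncomputable def coeffVec (k : Type*) [CommSemiring k] (N : ℕ) :
    MvPolynomial σ k →ₗ[k] (ExponentLE σ N → k) :=
  LinearMap.pi fun α => lcoeff k α.1

theorem coeffVec_map {R k : Type*} [CommSemiring R] [CommSemiring k] (φ : R →+* k) (N : ℕ)
    (p : MvPolynomial σ R) : coeffVec k N (p.map φ) = φ ∘ coeffVec R N p :=
  funext fun α => coeff_map φ p α.1

theorem eq_of_coeffVec_eq {k : Type*} [CommSemiring k] {N : ℕ} {p q : MvPolynomial σ k}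
    (hp : p.totalDegree ≤ N) (hq : q.totalDegree ≤ N) (hpq : coeffVec k N p = coeffVec k N q) :
    p = q := by
  ext α
  by_cases hα : α.degree ≤ N
  · exact congrFun hpq ⟨α, hα⟩
  · rw [coeff_eq_zero_of_totalDegree_lt (hp.trans_lt (not_le.1 hα)),
      coeff_eq_zero_of_totalDegree_lt (hq.trans_lt (not_le.1 hα))]

theorem monomialMultiples_image_map {R k : Type*} [CommSemiring R] [CommSemiring k] (φ : R →+* k)
    (S : Set (MvPolynomial σ R)) (c : ℕ) :
    monomialMultiples (map φ '' S) c = map φ '' monomialMultiples S c := by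
  simp only [monomialMultiples, Set.image_image2, Set.image2_image_right, map_mul, map_monomial,
    map_one]

theorem coeffVec_mem_span_of_map_mem_truncatedIdeal {R K : Type*} [CommSemiring R] [CommSemiring K]
    [Algebra R K] {S : Set (MvPolynomial σ R)} {c : ℕ} {p : MvPolynomial σ R}
    (hp : p.map (algebraMap R K) ∈ truncatedIdeal (map (algebraMap R K) '' S) c) (N : ℕ) :
    algebraMap R K ∘ coeffVec R N p ∈
      Submodule.span K ((algebraMap R K ∘ ·) '' (coeffVec R N '' monomialMultiples S c)) := by
  have hmap := Submodule.mem_map_of_mem (f := coeffVec K N) hp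
  rw [truncatedIdeal, Submodule.map_span, monomialMultiples_image_map, coeffVec_map] at hmap
  simpa only [Set.image_image, coeffVec_map] using hmap

/-- `g` certifies, with multipliers of degree at most `c`, that the ideal generated by the
polynomials `f i` contains the nonzero constant `a`. -/
structure IsCertificate {ι R : Type*} [Fintype ι] [CommSemiring R] (f : ι → MvPolynomial σ R)
    (c : ℕ) (a : R) (g : ι → MvPolynomial σ R) : Prop where
  ne_zero : a ≠ 0
  C_eq : C a = ∑ i, f i * g i
  totalDegree_le : ∀ i, (g i).totalDegree ≤ c

namespace IsCertificate

variable {ι R : Type*} [Fintype ι] [CommSemiring R] {f g : ι → MvPolynomial σ R} {c : ℕ} {a : R}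
  (hg : IsCertificate f c a g)
include hg

theorem mono {c' : ℕ} (hc : c ≤ c') : IsCertificate f c' a g :=
  ⟨hg.ne_zero, hg.C_eq, fun i => (hg.totalDegree_le i).trans hc⟩

theorem exists_mul_ne_zero : ∃ i, f i * g i ≠ 0 := by
  obtain ⟨i, -, hi⟩ := Finset.exists_ne_zero_of_sum_ne_zero (hg.C_eq ▸ C_ne_zero.2 hg.ne_zero)
  exact ⟨i, hi⟩

end IsCertificate

variable {ι R : Type*} [CommRing R]

theorem sum_smul_monomial_mul {κ : Type*} [Fintype κ] [Fintype ι] [DecidableEq ι]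
    (f : ι → MvPolynomial σ R) (x : κ → R) (β : κ → σ →₀ ℕ) (j : κ → ι) :
    ∑ k, x k • (monomial (β k) 1 * f (j k)) =
      ∑ i, f i * ∑ k with j k = i, monomial (β k) (x k) := by
  simp only [Finset.mul_sum]
  rw [← Finset.sum_fiberwise (g := j)]
  refine Finset.sum_congr rfl fun i _ => Finset.sum_congr rfl fun k hk => ?_
  rw [(Finset.mem_filter.1 hk).2, ← smul_mul_assoc, smul_monomial, smul_eq_mul, mul_one, mul_comm]

theorem exists_ne_zero_of_one_mem_truncatedIdeal [Nontrivial R] {S : Set (MvPolynomial σ R)}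
    {c : ℕ} (hS : 1 ∈ truncatedIdeal S c) : ∃ f ∈ S, f ≠ 0 := by
  by_contra! hzero
  have hbot : truncatedIdeal S c = ⊥ := by
    refine Submodule.span_eq_bot.2 ?_
    rintro _ ⟨α, -, f, hf, rfl⟩
    simp only [hzero f hf, mul_zero]
  exact one_ne_zero ((Submodule.mem_bot R).1 (hbot ▸ hS))

theorem totalDegree_smul_monomial_mul_le {f : MvPolynomial σ R} {c D : ℕ} (hf : f.totalDegree ≤ D)
    {β : σ →₀ ℕ} (hβ : β.degree ≤ c) (r : R) :
    (r • (monomial β 1 * f)).totalDegree ≤ c + D :=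
  (totalDegree_smul_le _ _).trans ((totalDegree_mul _ _).trans
    (add_le_add ((totalDegree_monomial_le _ _).trans hβ) hf))

theorem coeff_monomial_mul_le {γ : Type*} [LE γ] {h : R → γ} {b : γ} (h0 : h 0 ≤ b)
    {f : MvPolynomial σ R} (hf : ∀ α, h (coeff α f) ≤ b) (β α : σ →₀ ℕ) :
    h (coeff α (monomial β 1 * f)) ≤ b := by
  rw [coeff_monomial_mul', one_mul]
  split_ifs
  exacts [hf _, h0]

theorem coeff_C_le {γ : Type*} [LE γ] {h : R → γ} {b : γ} (h0 : h 0 ≤ b) {r : R} (hr : h r ≤ b)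
    (α : σ →₀ ℕ) : h (coeff α (C r)) ≤ b := by
  classical
  rw [coeff_C]
  split_ifs
  exacts [hr, h0]

namespace IsHeightOfType

variable {θ : ℕ → ℕ} {h : R → ℝ≥0} (hh : IsHeightOfType θ h) {m : ℕ}
include hh

theorem exists_bounded_combination [Finite σ] [IsDomain R] (K : Type*) [Field K] [Algebra R K]
    [FaithfulSMul R K] (h0 : h 0 ≤ m) {f : ι → MvPolynomial σ R} {c D : ℕ}
    (hD : ∀ i, (f i).totalDegree ≤ D) (hm : ∀ i α, h (coeff α (f i)) ≤ m)
    (hf : 1 ∈ truncatedIdeal (map (algebraMap R K) '' Set.range f) c) :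
    ∃ a ≠ 0, ∃ (x : ExponentLE σ (c + D) → R) (β : ExponentLE σ (c + D) → σ →₀ ℕ)
      (j : ExponentLE σ (c + D) → ι), (∀ k, (β k).degree ≤ c) ∧
      C a = ∑ k, x k • (monomial (β k) 1 * f (j k)) ∧
      h a ≤ heightBound θ m (detDepth (Fintype.card (ExponentLE σ (c + D))) + 1) ∧
      ∀ k, h (x k) ≤ heightBound θ m (detDepth (Fintype.card (ExponentLE σ (c + D)))) := by
  obtain ⟨i, α, hb⟩ : ∃ i α, coeff α (f i) ≠ 0 := by
    obtain ⟨_, ⟨_, ⟨i, rfl⟩, rfl⟩, hi⟩ := exists_ne_zero_of_one_mem_truncatedIdeal hf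
    exact ⟨i, ne_zero_iff.1 fun h0 => hi (by rw [h0, map_zero])⟩
  set b := coeff α (f i)
  have hCb : map (algebraMap R K) (C b) ∈
      truncatedIdeal (map (algebraMap R K) '' Set.range f) c := by
    rw [map_C, ← mul_one (C _), ← smul_eq_C_mul]
    exact Submodule.smul_mem _ _ hf
  have hU : ∀ u ∈ coeffVec R (c + D) '' monomialMultiples (Set.range f) c, ∀ α, h (u α) ≤ m := by
    rintro _ ⟨_, ⟨β, -, _, ⟨i, rfl⟩, rfl⟩, rfl⟩ α
    exact coeff_monomial_mul_le h0 (hm i) β α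
  have hbm (β : ExponentLE σ (c + D)) : h (coeffVec R (c + D) (C b) β) ≤ m :=
    coeff_C_le h0 (hm i α) β.1
  have hb0 : coeffVec R (c + D) (C b : MvPolynomial σ R) ≠ 0 := fun hzero =>
    hb (C_eq_zero.1 (eq_of_coeffVec_eq (by simp) (by simp) (hzero.trans (map_zero _).symm)))
  obtain ⟨a, ha, x, u, hu, hxu, ham, hxm⟩ := hh.exists_bounded_solution K h0 hU hb0 hbm
    (coeffVec_mem_span_of_map_mem_truncatedIdeal hCb _)
  choose p hp hpu using hu
  choose β hβ q hq hp using hp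
  choose j hj using hq
  refine ⟨a * b, mul_ne_zero ha hb, x, β, j, hβ, ?_,
    hh.mul_le_heightBound ham (le_heightBound_of_le (hm i α) _), hxm⟩
  refine eq_of_coeffVec_eq (N := c + D) (by simp only [totalDegree_C, zero_le])
    (totalDegree_finsetSum_le fun k _ => totalDegree_smul_monomial_mul_le (hD _) (hβ k) _) ?_
  simp only [map_sum, map_smul, hj, hp, hpu, hxu, C_mul, ← smul_eq_C_mul]

theorem sum_filter_monomial_le {κ : Type*} [Fintype κ] [DecidableEq ι] {k : ℕ}
    (h0 : h 0 ≤ heightBound θ m k) {x : κ → R} (hx : ∀ l, h (x l) ≤ heightBound θ m k)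
    (β : κ → σ →₀ ℕ) (j : κ → ι) (i : ι) (α : σ →₀ ℕ) :
    h (coeff α (∑ l with j l = i, monomial (β l) (x l))) ≤
      heightBound θ m (k + Fintype.card κ) := by
  classical
  rw [coeff_sum]
  refine le_heightBound_mono (Nat.add_le_add_left (Finset.card_le_univ _) k)
    (hh.sum_le_heightBound h0 _ fun l _ => ?_)
  rw [coeff_monomial]
  split_ifs
  exacts [hx l, h0]

end IsHeightOfType

theorem exists_bounded_certificate (σ : Type*) [Finite σ] (D : ℕ) :
    ∃ c L : ℕ, ∀ {R : Type u} [CommRing R] [IsDomain R] {θ : ℕ → ℕ} {h : R → ℝ≥0},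
      IsHeightOfType θ h → ∀ {m : ℕ} {ι : Type*} [Fintype ι] {f : ι → MvPolynomial σ R},
      (∀ x : σ → AlgebraicClosure (FractionRing R), ∃ i, aeval x (f i) ≠ 0) →
      (∀ i, (f i).totalDegree ≤ D) → (∀ i α, h (coeff α (f i)) ≤ m) →
      ∃ a g, IsCertificate f c a g ∧ h a ≤ heightBound θ m L ∧
        ∀ i α, h (coeff α (g i)) ≤ heightBound θ m L := by
  classical
  obtain ⟨c, hc⟩ := exists_one_mem_truncatedIdeal.{u} σ D
  let N := Fintype.card (ExponentLE σ (c + D))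
  refine ⟨c, detDepth N + 1 + N + 2, fun {R} _ _ {θ h} hh {m ι} _ {f} hf hD hm => ?_⟩
  let K := AlgebraicClosure (FractionRing R)
  have : FaithfulSMul R K := FaithfulSMul.trans R (FractionRing R) K
  have h0 : h 0 ≤ heightBound θ m 2 := hh.zero_le_heightBound (hm (hf 0).choose 0)
  have hmem : 1 ∈ truncatedIdeal (map (algebraMap R K) '' Set.range f) c := by
    refine hc K _ ?_ fun x => ?_
    · rintro _ ⟨_, ⟨i, rfl⟩, rfl⟩
      exact (totalDegree_map_le _ _).trans (hD i)
    · obtain ⟨i, hi⟩ := hf x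
      exact ⟨_, ⟨_, ⟨i, rfl⟩, rfl⟩, by rwa [eval_map, ← aeval_def]⟩
  obtain ⟨a, ha, x, β, j, hβ, hsum, ham, hxm⟩ := hh.exists_bounded_combination K h0 hD
    (fun i α => le_heightBound_of_le (hm i α) 2) hmem
  rw [sum_smul_monomial_mul] at hsum
  refine ⟨a, _, ⟨ha, hsum, fun i => ?_⟩, ?_, fun i α => ?_⟩
  · exact totalDegree_finsetSum_le fun k _ => (totalDegree_monomial_le _ _).trans (hβ k)
  · rw [← heightBound_heightBound]
    exact le_heightBound_mono (Nat.le_add_right _ _) ham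
  · rw [← heightBound_heightBound]
    refine le_heightBound_mono (k := detDepth N + N) (by lia)
      (hh.sum_filter_monomial_le (le_heightBound_of_le h0 _) hxm β j i α)

end Certificate

section RelPrimeFamily

/-- The elements `x k` have no common divisor other than units. -/
def IsRelPrimeFamily {κ M : Type*} [Monoid M] (x : κ → M) : Prop :=
  ∀ d, (∀ k, d ∣ x k) → IsUnit d

theorem exists_dvd_forall_and_isUnit {κ M : Type*} [CommMonoidWithZero M] [IsCancelMulZero M]
    [WfDvdMonoid M] {x : κ → M} {k : κ} (hk : x k ≠ 0) :
    ∃ d, (∀ j, d ∣ x j) ∧ ∀ e, (∀ j, d * e ∣ x j) → IsUnit e := by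
  obtain ⟨q, ⟨d, hdq, hd⟩, hmin⟩ := (wellFounded_dvdNotUnit (α := M)).has_min
    {q | ∃ d, x k = d * q ∧ ∀ j, d ∣ x j} ⟨x k, 1, (one_mul _).symm, fun _ => one_dvd _⟩
  refine ⟨d, hd, fun e he => ?_⟩
  by_contra hunit
  obtain ⟨q', hq'⟩ := he k
  have hd0 : d ≠ 0 := fun h0 => hk (by rw [hdq, h0, zero_mul])
  have hq'0 : q' ≠ 0 := fun h0 => hk (by rw [hq', h0, mul_zero])
  refine hmin q' ⟨d * e, hq', he⟩ ⟨hq'0, e, hunit, mul_left_cancel₀ hd0 ?_⟩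
  rw [← hdq, hq', mul_assoc, mul_comm e]

theorem IsRelPrimeFamily.dvd_of_forall_dvd_mul {κ M : Type*} [CommMonoidWithZero M] [Nontrivial M]
    [UniqueFactorizationMonoid M] {x : κ → M} (hx : IsRelPrimeFamily x) {e p : M}
    (h : ∀ k, e ∣ p * x k) : e ∣ p := by
  induction e using UniqueFactorizationMonoid.induction_on_prime generalizing p with
  | h₁ =>
    by_contra hp
    refine not_isUnit_zero (hx 0 fun k => ?_)
    simpa only [zero_dvd_iff, mul_eq_zero, zero_dvd_iff.not.1 hp, false_or] using h k
  | h₂ u hu => exact hu.dvd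
  | h₃ e q _ hq ih =>
    have hqp : q ∣ p := by
      by_contra hqp
      exact hq.not_isUnit (hx q fun k =>
        (hq.dvd_or_dvd (dvd_of_mul_right_dvd (h k))).resolve_left hqp)
    obtain ⟨p', rfl⟩ := hqp
    refine mul_dvd_mul_left q (ih fun k => ?_)
    exact (mul_dvd_mul_iff_left hq.ne_zero).1 (mul_assoc q p' (x k) ▸ h k)

end RelPrimeFamily

section PrimitivePart

variable {σ ι R : Type*} [CommRing R]

/-- The family of all coefficients of the polynomials `g i`. -/
def coeffFamily (g : ι → MvPolynomial σ R) : ι × (σ →₀ ℕ) → R :=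
  fun k => coeff k.2 (g k.1)

theorem finite_range_coeffFamily [Finite ι] (g : ι → MvPolynomial σ R) :
    (Set.range (coeffFamily g)).Finite := by
  refine (Set.finite_iUnion fun i => ((g i).coeffs.finite_toSet.insert 0)).subset ?_
  rintro _ ⟨⟨i, α⟩, rfl⟩
  refine Set.mem_iUnion.2 ⟨i, or_iff_not_imp_left.2 fun h0 => ?_⟩
  exact coeff_mem_coeffs α h0

variable [IsDomain R]

theorem totalDegree_C_mul {d : R} (hd : d ≠ 0) (q : MvPolynomial σ R) :
    (C d * q).totalDegree = q.totalDegree := by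
  obtain rfl | hq := eq_or_ne q 0
  · rw [mul_zero]
  · rw [totalDegree_mul_of_isDomain (C_ne_zero.2 hd) hq, totalDegree_C, zero_add]

theorem exists_eq_C_mul_isRelPrimeFamily [WfDvdMonoid R] {g : ι → MvPolynomial σ R} {i : ι}
    (hi : g i ≠ 0) :
    ∃ d ≠ 0, ∃ g', (∀ j, g j = C d * g' j) ∧ IsRelPrimeFamily (coeffFamily g') := by
  obtain ⟨α, hα⟩ := ne_zero_iff.1 hi
  obtain ⟨d, hd, hmax⟩ := exists_dvd_forall_and_isUnit (x := coeffFamily g) (k := (i, α)) hα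
  choose g' hg' using fun j => (C_dvd_iff_dvd_coeff d (g j)).2 fun β => hd (j, β)
  refine ⟨d, fun h0 => hi (by rw [hg' i, h0, C_0, zero_mul]), g', hg', fun e he =>
    hmax e fun ⟨j, β⟩ => ?_⟩
  rw [coeffFamily, hg' j, coeff_C_mul]
  exact mul_dvd_mul_left d (he (j, β))

variable [Fintype ι] {f : ι → MvPolynomial σ R}

theorem exists_syzygy_isRelPrimeFamily [WfDvdMonoid R] {D : ℕ} (hD : ∀ i, (f i).totalDegree ≤ D)
    {i j : ι} (hij : i ≠ j) (hi : f i ≠ 0) :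
    ∃ w : ι → MvPolynomial σ R, ∑ l, f l * w l = 0 ∧ (∀ l, (w l).totalDegree ≤ D) ∧
      IsRelPrimeFamily (coeffFamily w) := by
  classical
  let koszul : ι → MvPolynomial σ R := Pi.single i (f j) - Pi.single j (f i)
  have hsum : ∑ l, f l * koszul l = 0 := by
    rw [← dotProduct, dotProduct_sub, dotProduct_single, dotProduct_single, mul_comm, sub_self]
  have hdeg (l : ι) : (koszul l).totalDegree ≤ D := by
    have hsingle (a b : ι) : ((Pi.single a (f b) : ι → MvPolynomial σ R) l).totalDegree ≤ D := by
      rw [Pi.single_apply]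
      split_ifs
      exacts [hD b, totalDegree_zero.trans_le D.zero_le]
    exact (totalDegree_sub _ _).trans (max_le (hsingle i j) (hsingle j i))
  have hj : koszul j ≠ 0 := by simpa [koszul, hij.symm] using hi
  obtain ⟨b, hb, w, hw, hprim⟩ := exists_eq_C_mul_isRelPrimeFamily hj
  refine ⟨w, ?_, fun l => ?_, hprim⟩
  · refine (mul_eq_zero.1 ?_).resolve_left (C_ne_zero (σ := σ).2 hb)
    simpa only [Finset.mul_sum, mul_left_comm (C b), ← hw] using hsum
  · rw [← totalDegree_C_mul hb, ← hw]
    exact hdeg l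

namespace IsCertificate

variable {c : ℕ} {a : R} {g : ι → MvPolynomial σ R} (hg : IsCertificate f c a g)
include hg

theorem exists_eq_C_mul_isRelPrimeFamily [WfDvdMonoid R] :
    ∃ d ≠ 0, ∃ a' g', a = d * a' ∧ (∀ i, g i = C d * g' i) ∧ IsCertificate f c a' g' ∧
      IsRelPrimeFamily (coeffFamily g') := by
  obtain ⟨i, hi⟩ := hg.exists_mul_ne_zero
  obtain ⟨d, hd, g', hg', hprim⟩ := _root_.exists_eq_C_mul_isRelPrimeFamily
    (right_ne_zero_of_mul hi)
  have hsum : C a = C d * ∑ i, f i * g' i := by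
    simp only [hg.C_eq, hg', Finset.mul_sum, mul_left_comm]
  obtain ⟨a', rfl⟩ : d ∣ a := by
    simpa using map_dvd constantCoeff (Dvd.intro _ hsum.symm)
  refine ⟨d, hd, a', g', rfl, hg', ⟨right_ne_zero_of_mul hg.ne_zero, ?_, fun i => ?_⟩, hprim⟩
  · exact mul_left_cancel₀ (C_ne_zero.2 hd) (C_mul.symm.trans hsum)
  · rw [← totalDegree_C_mul hd, ← hg']
    exact hg.totalDegree_le i

theorem exists_eq_C_of_subsingleton [Subsingleton ι] : ∃ i b, b ≠ 0 ∧ f i = C b := by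
  obtain ⟨i, hi⟩ := hg.exists_mul_ne_zero
  have hfi := left_ne_zero_of_mul hi
  have hsum : C a = f i * g i := hg.C_eq.trans (Fintype.sum_subsingleton _ i)
  have hdeg := totalDegree_mul_of_isDomain hfi (right_ne_zero_of_mul hi)
  rw [← hsum, totalDegree_C, eq_comm, Nat.add_eq_zero_iff] at hdeg
  have hC := totalDegree_eq_zero_iff_eq_C.1 hdeg.1
  exact ⟨i, _, C_ne_zero.1 (hC ▸ hfi), hC⟩

end IsCertificate

end PrimitivePart

section Twist

variable {σ ι R : Type*} [CommRing R]

/-- The multipliers `P gᵢ + z ^ (c + 1) Q wᵢ`, where `z` is a variable. If the `gᵢ` have degree at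
most `c`, the two summands share no monomial, and every coefficient is a multiple of `P` or `Q`. -/
noncomputable def twist (z : σ) (c : ℕ) (P Q : R) (g w : ι → MvPolynomial σ R) :
    ι → MvPolynomial σ R :=
  fun i => C P * g i + monomial (Finsupp.single z (c + 1)) Q * w i

theorem coeff_eq_zero_of_single_le {z : σ} {c : ℕ} {p : MvPolynomial σ R} (hp : p.totalDegree ≤ c)
    {α : σ →₀ ℕ} (hα : Finsupp.single z (c + 1) ≤ α) : coeff α p = 0 := by
  refine coeff_eq_zero_of_totalDegree_lt (hp.trans_lt ?_)
  exact (Finsupp.degree_single z (c + 1)).symm.trans_le (Finsupp.degree_mono hα)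

theorem coeff_twist (z : σ) {c : ℕ} (P Q : R) {g : ι → MvPolynomial σ R}
    (hg : ∀ i, (g i).totalDegree ≤ c) (w : ι → MvPolynomial σ R) (i : ι) (α : σ →₀ ℕ) :
    coeff α (twist z c P Q g w i) =
      if Finsupp.single z (c + 1) ≤ α then Q * coeff (α - Finsupp.single z (c + 1)) (w i)
      else P * coeff α (g i) := by
  rw [twist, coeff_add, coeff_C_mul, coeff_monomial_mul']
  split_ifs with hα
  · rw [coeff_eq_zero_of_single_le (hg i) hα, mul_zero, zero_add]
  · rw [add_zero]

theorem isRelPrimeFamily_coeffFamily_twist [IsDomain R] [UniqueFactorizationMonoid R] (z : σ)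
    {c : ℕ} {P Q : R} (hPQ : IsRelPrime P Q) {g w : ι → MvPolynomial σ R}
    (hg : ∀ i, (g i).totalDegree ≤ c) (hgprim : IsRelPrimeFamily (coeffFamily g))
    (hwprim : IsRelPrimeFamily (coeffFamily w)) :
    IsRelPrimeFamily (coeffFamily (twist z c P Q g w)) := by
  intro e he
  simp only [coeffFamily, Prod.forall, coeff_twist z P Q hg w] at he
  refine hPQ (hgprim.dvd_of_forall_dvd_mul fun ⟨i, α⟩ => ?_)
    (hwprim.dvd_of_forall_dvd_mul fun ⟨i, α⟩ => ?_)
  · by_cases hα : Finsupp.single z (c + 1) ≤ α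
    · rw [coeffFamily, coeff_eq_zero_of_single_le (hg i) hα, mul_zero]
      exact dvd_zero e
    · simpa only [coeffFamily, if_neg hα] using he i α
  · simpa only [coeffFamily, le_add_iff_nonneg_left, zero_le, if_true, add_tsub_cancel_right] using
      he i (α + Finsupp.single z (c + 1))

theorem IsCertificate.twist [IsDomain R] [Fintype ι] {f g w : ι → MvPolynomial σ R} {c D : ℕ}
    {a : R} (hg : IsCertificate f c a g) (z : σ) {P : R} (hP : P ≠ 0) (Q : R)
    (hw : ∑ i, f i * w i = 0) (hwD : ∀ i, (w i).totalDegree ≤ D) :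
    IsCertificate f (c + 1 + D) (P * a) (twist z c P Q g w) where
  ne_zero := mul_ne_zero hP hg.ne_zero
  C_eq := by
    simp only [_root_.twist, mul_add, Finset.sum_add_distrib, mul_left_comm (f _),
      ← Finset.mul_sum, hw, mul_zero, add_zero, C_mul, hg.C_eq]
  totalDegree_le i := by
    refine (totalDegree_add _ _).trans (max_le ?_ ?_)
    · exact (totalDegree_C_mul hP _).trans_le ((hg.totalDegree_le i).trans (by lia))
    · refine (totalDegree_mul _ _).trans (add_le_add ?_ (hwD i))
      exact (totalDegree_monomial_le _ _).trans_eq (Finsupp.degree_single z (c + 1))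

end Twist

section PrimitiveCertificate

variable {R : Type*} [CommRing R]

theorem exists_pow_mul_le_one [Nontrivial R] (v : AbsoluteValue R ℝ) {p : R} (hp : v p < 1)
    {S : Set R} (hS : S.Finite) : ∃ k : ℕ, ∀ x ∈ S, v (p ^ k * x) ≤ 1 := by
  refine ((Filter.eventually_all_finite hS).2 fun x _ => ?_).exists (f := Filter.atTop)
  have hlim := (tendsto_pow_atTop_nhds_zero_of_lt_one (v.nonneg p) hp).mul_const (v x)
  rw [zero_mul] at hlim
  simp only [map_mul, map_pow]
  exact hlim.eventually_le_const one_pos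

theorem IsCertificate.exists_relPrime_certificate_of_subsingleton [IsDomain R]
    {σ ι : Type*} [Fintype ι] [Subsingleton ι] {f g : ι → MvPolynomial σ R} {c : ℕ} {a : R}
    (hg : IsCertificate f c a g) {v : AbsoluteValue R ℝ} {B : ℝ} (hB : 1 ≤ B)
    (hfB : ∀ i α, v (coeff α (f i)) ≤ B) :
    ∃ a g, IsCertificate f c a g ∧ v a ≤ B ∧ (∀ i α, v (coeff α (g i)) ≤ B) ∧
      IsRelPrimeFamily (coeffFamily g) := by
  obtain ⟨i, b, hb, hfi⟩ := hg.exists_eq_C_of_subsingleton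
  have hbB : v b ≤ B := by simpa only [hfi, coeff_zero_C] using hfB i 0
  have h0B : v 0 ≤ B := (map_zero v).trans_le (zero_le_one.trans hB)
  refine ⟨b, fun _ => C 1, ⟨hb, ?_, fun _ => (totalDegree_C 1).trans_le c.zero_le⟩, hbB,
    fun _ => coeff_C_le h0B (v.map_one.trans_le hB), fun e he => ?_⟩
  · rw [Fintype.sum_subsingleton _ i, hfi, C_1, mul_one]
  · exact isUnit_of_dvd_one (by simpa only [coeffFamily, coeff_zero_C] using he (i, 0))

namespace IsUFDWithPProperty

variable [IsDomain R] {v : AbsoluteValue R ℝ} (hv : IsUFDWithPProperty v)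
include hv

theorem one_le_of_forall_prime (hp : ∀ p, Prime p → 1 ≤ v p) {d : R} (hd : d ≠ 0) : 1 ≤ v d := by
  have := hv.ufd
  induction d using UniqueFactorizationMonoid.induction_on_prime with
  | h₁ => exact absurd rfl hd
  | h₂ x hx => exact (hv.abs_unit x hx).ge
  | h₃ a p ha hpp ih =>
    rw [map_mul]
    exact one_le_mul_of_one_le_of_one_le (hp p hpp) (ih ha)

theorem le_one_of_forall_prime (hp : ∀ p, Prime p → v p ≤ 1) (d : R) : v d ≤ 1 := by
  have := hv.ufd
  induction d using UniqueFactorizationMonoid.induction_on_prime with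
  | h₁ => exact (map_zero v).trans_le zero_le_one
  | h₂ x hx => exact (hv.abs_unit x hx).le
  | h₃ a p _ hpp ih =>
    rw [map_mul]
    exact mul_le_one₀ (hp p hpp) (v.nonneg _) ih

variable {σ ι : Type*} [Fintype ι] {f g : ι → MvPolynomial σ R} {c D : ℕ} {a : R} {B : ℝ}

theorem exists_relPrime_certificate_of_one_le (hlarge : ∀ d, d ≠ 0 → 1 ≤ v d)
    (hg : IsCertificate f c a g) (haB : v a ≤ B) (hgB : ∀ i α, v (coeff α (g i)) ≤ B) :
    ∃ a g, IsCertificate f c a g ∧ v a ≤ B ∧ (∀ i α, v (coeff α (g i)) ≤ B) ∧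
      IsRelPrimeFamily (coeffFamily g) := by
  have := hv.ufd
  obtain ⟨d, hd, a', g', rfl, hgg', hg', hprim⟩ := hg.exists_eq_C_mul_isRelPrimeFamily
  have hle (x : R) : v x ≤ v (d * x) := by
    rw [map_mul]
    exact le_mul_of_one_le_left (v.nonneg x) (hlarge d hd)
  refine ⟨a', g', hg', (hle a').trans haB, fun i α => (hle _).trans ?_, hprim⟩
  rw [← coeff_C_mul, ← hgg']
  exact hgB i α

theorem exists_relPrime_certificate_of_prime [Nonempty σ] {p r : R} (hp : Prime p) (hr : Prime r)
    (hrp : ¬ Associated r p) (hp1 : v p < 1) (hr1 : v r < 1) (hD : ∀ i, (f i).totalDegree ≤ D)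
    {i j : ι} (hij : i ≠ j) (hi : f i ≠ 0) (hg : IsCertificate f c a g) :
    ∃ a g, IsCertificate f (c + 1 + D) a g ∧ v a ≤ 1 ∧ (∀ i α, v (coeff α (g i)) ≤ 1) ∧
      IsRelPrimeFamily (coeffFamily g) := by
  have := hv.ufd
  obtain ⟨d, -, a', g', -, -, hg', hgprim⟩ := hg.exists_eq_C_mul_isRelPrimeFamily
  obtain ⟨w, hw, hwD, hwprim⟩ := exists_syzygy_isRelPrimeFamily hD hij hi
  obtain ⟨k, hk⟩ := exists_pow_mul_le_one v hp1 ((finite_range_coeffFamily g').insert a')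
  obtain ⟨l, hl⟩ := exists_pow_mul_le_one v hr1 (finite_range_coeffFamily w)
  have hpr : IsRelPrime p r := hp.irreducible.isRelPrime_iff_not_dvd.2 fun hdvd =>
    hrp (hp.associated_of_dvd hr hdvd).symm
  let z : σ := Classical.arbitrary σ
  refine ⟨_, _, hg'.twist z (pow_ne_zero k hp.ne_zero) (r ^ l) hw hwD, hk _ (Set.mem_insert _ _),
    fun i α => ?_, isRelPrimeFamily_coeffFamily_twist z hpr.pow hg'.totalDegree_le hgprim hwprim⟩
  rw [coeff_twist z _ _ hg'.totalDegree_le]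
  split_ifs
  · exact hl _ ⟨(i, _), rfl⟩
  · exact hk _ (Set.mem_insert_of_mem _ ⟨(i, α), rfl⟩)

theorem exists_relPrime_certificate [Nonempty σ] (hB : 1 ≤ B) (hD : ∀ i, (f i).totalDegree ≤ D)
    (hfB : ∀ i α, v (coeff α (f i)) ≤ B) (hg : IsCertificate f c a g) (haB : v a ≤ B)
    (hgB : ∀ i α, v (coeff α (g i)) ≤ B) :
    ∃ a g, IsCertificate f (c + 1 + D) a g ∧ v a ≤ B ∧ (∀ i α, v (coeff α (g i)) ≤ B) ∧
      IsRelPrimeFamily (coeffFamily g) := by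
  have hcert : IsCertificate f (c + 1 + D) a g := hg.mono (by lia)
  by_cases hsmall : ∃ p, Prime p ∧ v p < 1
  swap
  · push Not at hsmall
    exact hv.exists_relPrime_certificate_of_one_le (fun d => hv.one_le_of_forall_prime hsmall)
      hcert haB hgB
  by_cases hlarge : ∃ q, Prime q ∧ 1 < v q
  swap
  · push Not at hlarge
    have hle (x : R) : v x ≤ B := (hv.le_one_of_forall_prime hlarge x).trans hB
    have := hv.ufd
    obtain ⟨-, -, a', g', -, -, hg', hprim⟩ := hcert.exists_eq_C_mul_isRelPrimeFamily
    exact ⟨a', g', hg', hle _, fun _ _ => hle _, hprim⟩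
  obtain ⟨p, hp, hp1⟩ := hsmall
  obtain ⟨q, hq, hq1⟩ := hlarge
  obtain ⟨r, hr, hrp, hr1⟩ := hv.exists_prime p q hp hq hp1 hq1
  cases subsingleton_or_nontrivial ι
  · exact hcert.exists_relPrime_certificate_of_subsingleton hB hfB
  obtain ⟨i, hi⟩ := hg.exists_mul_ne_zero
  obtain ⟨j, hj⟩ := exists_ne i
  obtain ⟨a', g', hg', ha1, hg1, hprim⟩ :=
    hv.exists_relPrime_certificate_of_prime hp hr hrp hp1 hr1 hD hj.symm
      (left_ne_zero_of_mul hi) hg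
  exact ⟨a', g', hg', ha1.trans hB, fun i α => (hg1 i α).trans hB, hprim⟩

end IsUFDWithPProperty

end PrimitiveCertificate

theorem coeff_le_polyHeight {R : Type*} [CommRing R] {n : ℕ} (h : R → ℝ≥0)
    (f : MvPolynomial (Fin n) R) (α : Fin n →₀ ℕ) : h (coeff α f) ≤ polyHeight h f :=
  le_ciSup (bddAbove_range_height_coeff h f) α

theorem NoCommonZero.exists_aeval_ne_zero {R : Type*} [CommRing R] [IsDomain R] {n s : ℕ}
    {f : Fin s → MvPolynomial (Fin n) R} (hf : NoCommonZero f)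
    (x : Fin n → AlgebraicClosure (FractionRing R)) : ∃ i, aeval x (f i) ≠ 0 :=
  not_forall.1 (not_exists.1 hf x)

theorem theoremA (n D : ℕ) (hn : 1 ≤ n) (hD : 1 ≤ D) :
    ∃ c₁ : ℕ, ∀ (H : ℝ≥0) (_ : 1 ≤ H) (θ : ℕ → ℕ), ∃ c₂ : ℝ≥0,
      ∀ (R : Type u) [CommRing R] [IsDomain R] (h : R → ℝ≥0), IsHeightOfType θ h →
      ∀ (s : ℕ) (f : Fin s → MvPolynomial (Fin n) R), NoCommonZero f →
        (∀ i, (f i).totalDegree ≤ D) → (∀ i, polyHeight h (f i) ≤ H) →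
        ∃ (a : R) (g : Fin s → MvPolynomial (Fin n) R), a ≠ 0 ∧
          MvPolynomial.C a = ∑ i, f i * g i ∧
          (∀ i, (g i).totalDegree ≤ c₁) ∧
          (h a ≤ c₂ ∧ ∀ i, polyHeight h (g i) ≤ c₂) ∧
          (∀ v : AbsoluteValue R ℝ, IsUFDWithPProperty v → (∀ x, (h x : ℝ) = v x) →
            ∀ d : R, d ∣ a → (∀ i α, d ∣ (g i).coeff α) → IsUnit d) := by
  have : Nonempty (Fin n) := ⟨⟨0, hn⟩⟩
  obtain ⟨c, L, hcert⟩ := exists_bounded_certificate.{u} (Fin n) D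
  refine ⟨c + 1 + D, fun H hH θ => ⟨max H (heightBound θ ⌈H⌉₊ L), ?_⟩⟩
  intro R _ _ h hh s f hf hfD hfH
  have hfh (i α) : h (coeff α (f i)) ≤ H := (coeff_le_polyHeight h (f i) α).trans (hfH i)
  obtain ⟨a, g, hg, ha, hgh⟩ :=
    hcert hh hf.exists_aeval_ne_zero hfD fun i α => (hfh i α).trans (Nat.le_ceil H)
  have ha' := le_max_of_le_right (b := H) ha
  have hgh' (i α) := le_max_of_le_right (b := H) (hgh i α)
  by_cases hv : ∃ v : AbsoluteValue R ℝ, IsUFDWithPProperty v ∧ ∀ x, (h x : ℝ) = v x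
  · obtain ⟨v, hv, hhv⟩ := hv
    obtain rfl : h = fun x => ⟨v x, v.nonneg x⟩ := funext fun x => NNReal.eq (hhv x)
    obtain ⟨b, w, hw, hb, hwh, hprim⟩ := hv.exists_relPrime_certificate (le_max_of_le_left hH) hfD
      (fun i α => le_max_of_le_left (hfh i α)) hg ha' hgh'
    exact ⟨b, w, hw.ne_zero, hw.C_eq, hw.totalDegree_le, ⟨hb, fun i => ciSup_le (hwh i)⟩,
      fun _ _ _ d _ hd => hprim d fun k => hd k.1 k.2⟩
  · exact ⟨a, g, hg.ne_zero, hg.C_eq, fun i => (hg.totalDegree_le i).trans (by lia),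
      ⟨ha', fun i => ciSup_le (hgh' i)⟩, fun v hv1 hv2 => absurd ⟨v, hv1, hv2⟩ hv⟩
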